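/- **Theorem 1.1.** Let $M$ be a (Hausdorff) smooth finite-dimensional manifold without boundary, for instance the underlying manifold of a Riemannian manifold. Let $k\in\mathbb N$ and $1\le p<\infty$ with $[k-2/p]\ge 1$. *Trees.* Let $T$ be a finite tree. A vertex $v$ is *unstable* if its valence $\mathrm{Val}(v)$ is at most $2$, and *stable* otherwise. Let $L:\{1,\dots,n\}\to T$ be a labelling of the vertices with $\mathrm{Val}(v)+\#L^{-1}(v)=3$ at every unstable vertex $v$, so that $\hat T=(T,L)$ is a minimal stabilization of $T$. The special points of a vertex $v$ are its double points $d_{vu}$, one for each neighbour $u$ of $v$, and its marked points $x_{vi}$, one for each $i\in L^{-1}(v)$. Fix for each $v$ an ordered choice of three of its special points. *Domains.* The fibres of the universal curve over $\mathcal M_{\hat T}$ are described by the positions $\mathbf p_v$ of the special points on a copy $\mathbf{CP}^1_v=\mathbb C\cup\{\infty\}$ of the sphere for each $v$: the special points of $v$ are distinct, and the three chosen ones lie at $0,1,\infty$ in this order. *Maps.* An $L_k^p$-map $u:\mathbf{CP}^1\to M$ is a continuous map such that, for every affine coordinate on $\mathbf{CP}^1$ (one obtained from the standard one by a Möbius transformation),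 every smooth chart $\psi$ of $M$, and every closed disc $\bar D$ in that coordinate that $u$ maps into the domain of $\psi$, the local representative $\psi\circ u$ is in the Sobolev space $L_k^p(D)$. The $L_k^p$-topology on these maps is generated by the sets of all $h$ that also map $\bar D$ into the domain of $\psi$ and satisfy $\|\psi\circ h-\psi\circ u\|_{L_k^p(D)}<\varepsilon$, for all such $u$, $D$, $\psi$ and all $\varepsilon>0$. *The space.* Let $\tilde{\mathcal B}^{\hat T}$ be the set of all $f=(\mathbf p_v,f_v)_{v\in T}$, where $(\mathbf p_v)_v$ is a domain as above, each $f_v:\mathbf{CP}^1_v\to M$ is an $L_k^p$-map, and $f_v(d_{vu})=f_u(d_{uv})$ whenever $u,v$ are adjacent. It carries the subspace topology from the product of the spaces of positions and of $L_k^p$-maps. *The group.* For an unstable $v$ let $G_v\subset \mathbf{PSL}(2,\mathbb C)$ be the subgroup fixing the double points of $\mathbf{CP}^1_v$; these have the same position, among $0,1,\infty$, for all domains. Let $G_T=\prod_v G_v$ over the unstable vertices $v$. It acts on $\tilde{\mathcal B}^{\hat T}$ by $(g\cdot f)_v=f_v\circ g_v^{-1}$, with $g_v=\mathrm{id}$ for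 stable $v$, and leaves the domain unchanged. *Claim.* With no stability assumption on the maps, $\tilde{\mathcal B}^{\hat T}$ is $G_T$-Hausdorff: whenever $G_Tf_1\ne G_Tf_2$, there are open neighbourhoods $U_1$ of $f_1$ and $U_2$ of $f_2$ such that $G_TU_1$ and $G_TU_2$ are open and $G_TU_1\cap G_TU_2=\varnothing$. Moreover, the global quotient $\tilde{\mathcal B}^{\hat T}/G_T$, with the quotient topology, is Hausdorff. -/

import Mathlib

open scoped Manifold ContDiff

noncomputable section

namespace NodalMaps

open Filter Topology MeasureTheory
open scoped ENNReal Matrix MatrixGroups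

/-! ### The Riemann sphere and its group of Möbius transformations -/

/-- The Riemann sphere `ℂ ∪ {∞}`. -/
abbrev CP1 : Type := OnePoint ℂ

theorem tendsto_inv_infty :
    Tendsto (fun w : ℂ => if w = 0 then (OnePoint.infty : CP1) else ((w⁻¹ : ℂ) : CP1)) (𝓝 0) (𝓝 OnePoint.infty) := by
  rw [← nhdsNE_sup_pure, tendsto_sup]
  constructor
  · have h : Tendsto (fun w : ℂ => ((w⁻¹ : ℂ) : CP1)) (𝓝[≠] 0) (𝓝 OnePoint.infty) := by
      have h1 : Tendsto (fun w : ℂ => w⁻¹) (𝓝[≠] 0) (coclosedCompact ℂ) := by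
        rw [coclosedCompact_eq_cocompact, ← Metric.cobounded_eq_cocompact]
        exact tendsto_inv₀_nhdsNE_zero
      exact OnePoint.tendsto_coe_infty.comp h1
    refine h.congr' ?_
    filter_upwards [self_mem_nhdsWithin] with w hw
    simp [show w ≠ 0 from hw]
  · rw [tendsto_pure_left]
    intro s hs
    simpa using mem_of_mem_nhds hs

theorem continuousAt_smul_coe (g : GL (Fin 2) ℂ) (z : ℂ) :
    ContinuousAt (fun w : ℂ => g • (w : CP1)) z := by
  have hdet : g 0 0 * g 1 1 - g 0 1 * g 1 0 ≠ 0 := by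
    have := g.det_ne_zero
    rwa [Matrix.det_fin_two] at this
  have hden : ContinuousAt (fun w : ℂ => g 1 0 * w + g 1 1) z := by fun_prop
  have hnum : ContinuousAt (fun w : ℂ => g 0 0 * w + g 0 1) z := by fun_prop
  by_cases hz : g 1 0 * z + g 1 1 = 0
  · have hn : g 0 0 * z + g 0 1 ≠ 0 := by
      intro h
      apply hdet
      by_cases h10 : g 1 0 = 0
      · have h11 : g 1 1 = 0 := by simpa [h10] using hz
        simp [h10, h11]
      · have : g 1 0 * (g 0 0 * g 1 1 - g 0 1 * g 1 0) = 0 := by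
          linear_combination g 1 0 * g 0 0 * hz - (g 1 0) ^ 2 * h
        exact (mul_eq_zero.mp this).resolve_left h10
    have hq : Tendsto (fun w : ℂ => (g 1 0 * w + g 1 1) / (g 0 0 * w + g 0 1)) (𝓝 z) (𝓝 0) := by
      have := (hden.div hnum hn).tendsto
      simp only [hz, zero_div, Pi.div_apply] at this
      exact this
    have hlim := tendsto_inv_infty.comp hq
    have hval : g • (z : CP1) = OnePoint.infty := by rw [OnePoint.smul_some_eq_ite, if_pos hz]
    rw [ContinuousAt, hval]
    refine hlim.congr' ?_
    filter_upwards [hnum.eventually_ne hn] with w hw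
    rw [OnePoint.smul_some_eq_ite]
    by_cases hw' : g 1 0 * w + g 1 1 = 0
    · simp [hw']
    · simp [hw', hw, inv_div]
  · have hc : ContinuousAt
        (fun w : ℂ => (((g 0 0 * w + g 0 1) / (g 1 0 * w + g 1 1) : ℂ) : CP1)) z :=
      OnePoint.continuous_coe.continuousAt.comp (hnum.div hden hz)
    refine hc.congr ?_
    filter_upwards [hden.eventually_ne hz] with w hw
    rw [OnePoint.smul_some_eq_ite, if_neg hw]

instance : ContinuousConstSMul (GL (Fin 2) ℂ) CP1 where
  continuous_const_smul g := by
    rw [OnePoint.continuous_iff]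
    refine ⟨?_, continuous_iff_continuousAt.mpr fun z => continuousAt_smul_coe g z⟩
    let S : GL (Fin 2) ℂ := Matrix.GeneralLinearGroup.mkOfDetNeZero !![0, 1; 1, 0] (by simp)
    have hS0 : S • ((0 : ℂ) : CP1) = OnePoint.infty := by
      rw [OnePoint.smul_some_eq_ite]
      simp [S, Matrix.GeneralLinearGroup.mkOfDetNeZero]
    have hSw : ∀ w : ℂ, w ≠ 0 → S • ((w⁻¹ : ℂ) : CP1) = (w : CP1) := by
      intro w hw
      rw [OnePoint.smul_some_eq_ite]
      simp [S, Matrix.GeneralLinearGroup.mkOfDetNeZero, hw]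
    have h := (continuousAt_smul_coe (g * S) 0).tendsto
    rw [mul_smul, hS0] at h
    have hinv : Tendsto (fun w : ℂ => w⁻¹) (coclosedCompact ℂ) (𝓝 0) := by
      rw [coclosedCompact_eq_cocompact, ← Metric.cobounded_eq_cocompact]
      exact tendsto_inv₀_cobounded
    refine (h.comp hinv).congr' ?_
    have hne : ∀ᶠ w : ℂ in coclosedCompact ℂ, w ≠ 0 := by
      rw [coclosedCompact_eq_cocompact]
      exact (isCompact_singleton (x := (0 : ℂ))).compl_mem_cocompact
    filter_upwards [hne] with w hw
    simp only [Function.comp_apply, mul_smul, hSw w hw]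

/-- A matrix `A` acts on the sphere by the homeomorphism `z ↦ (a z + b) / (c z + d)`. -/
def moebiusHom : GL (Fin 2) ℂ →* (CP1 ≃ₜ CP1) where
  toFun A := Homeomorph.smul A
  map_one' := by ext z; simp
  map_mul' A B := by ext z; simp [mul_smul]

/-- The group `PSL(2, ℂ)` of biholomorphic transformations of the sphere, realised as the group of
all Möbius transformations. -/
def moebius : Subgroup (CP1 ≃ₜ CP1) := moebiusHom.range

/-! ### Sobolev functions on a plane domain -/

section Sobolev

variable {E : Type*} [NormedAddCommGroup E] [NormedSpace ℝ E]

/-- The classical partial derivative `∂ₓᵃ ∂ᵧᵇ φ` at `z = x + i y`. -/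
def partialDeriv (a b : ℕ) (φ : ℂ → ℝ) (z : ℂ) : ℝ :=
  iteratedFDeriv ℝ (a + b) φ z (fun i => if (i : ℕ) < a then 1 else Complex.I)

/-- `G` is the weak partial derivative `∂ₓᵃ ∂ᵧᵇ F` on the open set `D`. -/
def IsWeakPartial (D : Set ℂ) (a b : ℕ) (F G : ℂ → E) : Prop :=
  ∀ φ : ℂ → ℝ, ContDiff ℝ ∞ φ → HasCompactSupport φ → tsupport φ ⊆ D →
    ∫ z in D, partialDeriv a b φ z • F z = (-1 : ℝ) ^ (a + b) • ∫ z in D, φ z • G z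

/-- `F ∈ L^p(D)`, and `G a b ∈ L^p(D)`, `a + b ≤ k`, are the weak derivatives of `F`. -/
def IsSobolevJet (k : ℕ) (p : ℝ) (D : Set ℂ) (F : ℂ → E) (G : ℕ → ℕ → ℂ → E) : Prop :=
  MemLp F (ENNReal.ofReal p) (volume.restrict D) ∧
    ∀ a b : ℕ, a + b ≤ k →
      MemLp (G a b) (ENNReal.ofReal p) (volume.restrict D) ∧ IsWeakPartial D a b F (G a b)

/-- `F` belongs to the Sobolev space `L_k^p(D)`. -/
def MemSobolev (k : ℕ) (p : ℝ) (D : Set ℂ) (F : ℂ → E) : Prop :=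
  ∃ G : ℕ → ℕ → ℂ → E, IsSobolevJet k p D F G

/-- The Sobolev norm: the sum over `a + b ≤ k` of the `L^p(D)`-norms of the weak derivatives
(which are unique up to null sets); it is `∞` outside `L_k^p(D)`. -/
def sobolevNorm (k : ℕ) (p : ℝ) (D : Set ℂ) (F : ℂ → E) : ℝ≥0∞ :=
  ⨅ G : {G : ℕ → ℕ → ℂ → E // IsSobolevJet k p D F G},
    ∑ j ∈ Finset.range (k + 1), ∑ ab ∈ Finset.HasAntidiagonal.antidiagonal j,
      eLpNorm (G.1 ab.1 ab.2) (ENNReal.ofReal p) (volume.restrict D)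

end Sobolev

/-! ### The space of `L_k^p`-maps from the sphere to a manifold -/

section Maps

variable (m : ℕ) (M : Type*) [TopologicalSpace M] [ChartedSpace (EuclideanSpace ℝ (Fin m)) M]

/-- The disc `|w - z| < r` in the affine coordinate `w ↦ γ w` of the sphere together with the
chart `ψ` of the target are adapted to `u` if `u` maps the closed disc into the domain of `ψ`. -/
def Adapted (u : CP1 → M) (γ : moebius) (z : ℂ) (r : ℝ)
    (ψ : OpenPartialHomeomorph M (EuclideanSpace ℝ (Fin m))) : Prop :=
  ∀ w ∈ Metric.closedBall z r, u (γ.1 (w : CP1)) ∈ ψ.source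

/-- The local representative `ψ ∘ u ∘ γ`. -/
def localRep (u : CP1 → M) (γ : moebius)
    (ψ : OpenPartialHomeomorph M (EuclideanSpace ℝ (Fin m))) (w : ℂ) :
    EuclideanSpace ℝ (Fin m) :=
  ψ (u (γ.1 (w : CP1)))

/-- An `L_k^p`-map from the sphere to `M` (in the range `k p > 2`): a continuous map all of whose
local representatives, in affine coordinates `γ` of the sphere and smooth charts of `M`, are of
class `L_k^p`. -/
structure LkpMap (k : ℕ) (p : ℝ) where
  toMap : C(CP1, M)
  sobolev : ∀ (γ : moebius) (z : ℂ) (r : ℝ), 0 < r → ∀ ψ ∈ IsManifold.maximalAtlas (𝓡 m) ∞ M,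
    Adapted m M toMap γ z r ψ → MemSobolev k p (Metric.ball z r) (localRep m M toMap γ ψ)

namespace LkpMap

variable {m M} {k : ℕ} {p : ℝ}

theorem ext {u h : LkpMap m M k p} (H : ∀ x, u.toMap x = h.toMap x) : u = h := by
  cases u; cases h
  congr
  exact ContinuousMap.ext H

/-- The basic neighbourhood of `u`: all `h` that map the closed disc into the domain of `ψ` as `u`
does and whose local representative there has `L_k^p`-distance less than `ε` from that of `u`. -/
def basicNhd (u : LkpMap m M k p) (γ : moebius) (z : ℂ) (r : ℝ)
    (ψ : OpenPartialHomeomorph M (EuclideanSpace ℝ (Fin m))) (ε : ℝ≥0∞) : Set (LkpMap m M k p) :=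
  {h | Adapted m M h.toMap γ z r ψ ∧
    sobolevNorm k p (Metric.ball z r)
      (fun w => localRep m M h.toMap γ ψ w - localRep m M u.toMap γ ψ w) < ε}

/-- The `L_k^p`-topology, generated by all basic neighbourhoods. -/
instance : TopologicalSpace (LkpMap m M k p) :=
  TopologicalSpace.generateFrom
    {N | ∃ (u : LkpMap m M k p) (γ : moebius) (z : ℂ) (r : ℝ)
      (ψ : OpenPartialHomeomorph M (EuclideanSpace ℝ (Fin m))) (ε : ℝ≥0∞),
      0 < r ∧ ψ ∈ IsManifold.maximalAtlas (𝓡 m) ∞ M ∧ Adapted m M u.toMap γ z r ψ ∧ 0 < ε ∧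
        N = basicNhd u γ z r ψ ε}

/-- The reparametrization `u ∘ g` of an `L_k^p`-map. -/
def comp (u : LkpMap m M k p) (g : moebius) : LkpMap m M k p where
  toMap := u.toMap.comp (g.1 : C(CP1, CP1))
  sobolev γ z r hr ψ hψ had := u.sobolev (g * γ) z r hr ψ hψ had

end LkpMap

end Maps

/-! ### Labelled trees -/

section Trees

variable {V : Type*}

/-- The special points of the component `v` of a curve modelled on the tree `G` labelled by `L`:
a double point for every neighbour of `v`, a marked point for every label at `v`. -/
abbrev SpecialPoint (G : SimpleGraph V) {n : ℕ} (L : Fin n → V) (v : V) : Type _ :=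
  G.neighborSet v ⊕ {i : Fin n // L i = v}

/-- A tree together with a minimal stabilization: labels `1, …, n` are distributed over the
vertices so that every unstable vertex (one of valence at most two) carries exactly three special
points. (So every vertex carries at least three.) The field `frame` chooses the three special
points of each component that are put at `0`, `1`, `∞`. -/
structure StabilizedTree (V : Type*) where
  graph : SimpleGraph V
  isTree : graph.IsTree
  n : ℕ
  label : Fin n → V
  minimal : ∀ v, Nat.card (graph.neighborSet v) ≤ 2 →
    Nat.card (graph.neighborSet v) + Nat.card {i : Fin n // label i = v} = 3
  frame : ∀ v, Fin 3 ↪ SpecialPoint graph label v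

/-- The three standard points `0`, `1`, `∞` of the sphere. -/
def stdPoint : Fin 3 → CP1 := ![((0 : ℂ) : CP1), ((1 : ℂ) : CP1), OnePoint.infty]

namespace StabilizedTree

variable (T : StabilizedTree V)

/-- A vertex is unstable if its valence is at most two. -/
def Unstable (v : V) : Prop := Nat.card (T.graph.neighborSet v) ≤ 2

theorem frame_surjective [Finite V] {v : V} (hv : T.Unstable v) :
    Function.Surjective (T.frame v) := by
  have hcard : Nat.card (SpecialPoint T.graph T.label v) = 3 := by
    rw [Nat.card_sum]; exact T.minimal v hv
  have hbij := (Nat.bijective_iff_injective_and_card (T.frame v)).mpr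
    ⟨(T.frame v).injective, by rw [hcard]; simp⟩
  exact hbij.2

/-- The reparametrization group of the component `v`: for an unstable component, the Möbius
transformations that fix all its double points (all its special points are in standard position,
the same for all curves modelled on the tree); for a stable component, the trivial group. -/
def componentGroup (v : V) : Subgroup moebius where
  carrier := {g | (¬ T.Unstable v → g = 1) ∧
    ∀ (j : Fin 3) (d : T.graph.neighborSet v), T.frame v j = Sum.inl d →
      g.1 (stdPoint j) = stdPoint j}
  one_mem' := ⟨fun _ => rfl, fun _ _ _ => rfl⟩
  mul_mem' {a b} ha hb := ⟨fun h => by rw [ha.1 h, hb.1 h, one_mul], fun j d hd => by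
    change a.1 (b.1 (stdPoint j)) = stdPoint j
    rw [hb.2 j d hd, ha.2 j d hd]⟩
  inv_mem' {a} ha := ⟨fun h => by rw [ha.1 h, inv_one], fun j d hd => by
    change a.1.symm (stdPoint j) = stdPoint j
    rw [Homeomorph.symm_apply_eq, ha.2 j d hd]⟩

/-- The group `G_T`, the product of the reparametrization groups of the components. -/
def reparamGroup : Subgroup (V → moebius) := Subgroup.pi Set.univ T.componentGroup

end StabilizedTree

end Trees

/-! ### Nodal maps -/

section Nodal

variable {V : Type*} (T : StabilizedTree V) (m : ℕ) (M : Type*) [TopologicalSpace M]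
  [ChartedSpace (EuclideanSpace ℝ (Fin m)) M] (k : ℕ) (p : ℝ)

/-- A nodal `L_k^p`-map whose domain is a fibre of the universal curve: the positions of the
special points on the components, distinct on each component and normalised by the frame, together
with an `L_k^p`-map on each component, such that the values at the two branches of each double
point agree. -/
structure NodalMap where
  point : ∀ v, SpecialPoint T.graph T.label v → CP1
  point_injective : ∀ v, Function.Injective (point v)
  point_frame : ∀ v j, point v (T.frame v j) = stdPoint j
  map : V → LkpMap m M k p
  compat : ∀ (u v : V) (h : T.graph.Adj u v),
    (map u).toMap (point u (Sum.inl ⟨v, h⟩)) = (map v).toMap (point v (Sum.inl ⟨u, h.symm⟩))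

namespace NodalMap

variable {T m M k p}

theorem ext {f h : NodalMap T m M k p} (H₁ : f.point = h.point) (H₂ : f.map = h.map) : f = h := by
  cases f; cases h
  congr

/-- The topology on nodal maps, as a subspace of the product of the configurations of special
points and of the spaces of `L_k^p`-maps on the components. -/
instance : TopologicalSpace (NodalMap T m M k p) :=
  TopologicalSpace.induced (fun f => (f.point, f.map)) inferInstance

theorem reparam_fixes [Finite V] (f : NodalMap T m M k p) {g : V → moebius}
    (hg : g ∈ T.reparamGroup) (v : V) (d : T.graph.neighborSet v) :
    (g v).1 (f.point v (Sum.inl d)) = f.point v (Sum.inl d) := by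
  have hv := hg v (Set.mem_univ v)
  by_cases h : T.Unstable v
  · obtain ⟨j, hj⟩ := T.frame_surjective h (Sum.inl d)
    rw [← hj, f.point_frame]
    exact hv.2 j d hj
  · rw [hv.1 h]; rfl

/-- `G_T` acts by `(g • f)_v = f_v ∘ g_v⁻¹`, with the domain curve unchanged. -/
instance [Finite V] : MulAction T.reparamGroup (NodalMap T m M k p) where
  smul g f :=
    { point := f.point
      point_injective := f.point_injective
      point_frame := f.point_frame
      map := fun v => (f.map v).comp (g.1 v)⁻¹
      compat := fun u v h => by
        change (f.map u).toMap (((g⁻¹).1 u).1 _) = (f.map v).toMap (((g⁻¹).1 v).1 _)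
        rw [f.reparam_fixes (g⁻¹).2, f.reparam_fixes (g⁻¹).2]
        exact f.compat u v h }
  one_smul f := NodalMap.ext rfl (funext fun v => LkpMap.ext fun x => by
    change (f.map v).toMap ((1 : moebius)⁻¹.1 x) = _
    rw [inv_one]; rfl)
  mul_smul a b f := NodalMap.ext rfl (funext fun v => LkpMap.ext fun x => by
    change (f.map v).toMap ((a.1 v * b.1 v)⁻¹.1 x) = (f.map v).toMap ((b.1 v)⁻¹.1 ((a.1 v)⁻¹.1 x))
    rw [mul_inv_rev]; rfl)

/-- The saturation `G_T U = ⋃ g, g • U`. -/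
def saturation [Finite V] (U : Set (NodalMap T m M k p)) : Set (NodalMap T m M k p) :=
  {h | ∃ g : T.reparamGroup, ∃ f ∈ U, h = g • f}

end NodalMap

end Nodal

end NodalMaps

end

/-! The orbit relation is closed: if `h i → f₁` and `g i • h i → f₂` along an ultrafilter, then `f₁`
and `f₂` lie in one orbit (`exists_smul_eq_of_tendsto`). Disjoint saturated neighbourhoods follow by
filter duality, and the quotient is Hausdorff because its projection is open.

The group is a product of subgroups of `PSL(2, ℂ)`, so each component can be treated separately
(`LkpMap.eq_or_exists_eq_comp`). Let `h i → u₁` and `h i ∘ (g i)⁻¹ → u₂`. Matrices scaled to norm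
one have a nonzero limit `B`. If `B` is invertible, the `(g i)⁻¹` converge to a Möbius map `γ`, and
`u₂ = u₁ ∘ γ`. If `B` has rank one, they converge to a constant off at most one point, which makes
`u₂` constant; then `u₁` is the same constant, and the identity relates the two. Thus noncompactness
of the group shows only on constant maps, where the group acts trivially; no stability is needed.

The only analytic inputs are that evaluation is jointly continuous (`LkpMap.continuous_eval`) and
that composition with a fixed Möbius map is continuous (`LkpMap.continuous_comp`). -/

noncomputable section

namespace NodalMaps

open Filter Topology

/-! ### Pointwise limits of Möbius transformations -/

/-- The point of the sphere with homogeneous coordinates `a : b`. -/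
def ratio (a b : ℂ) : CP1 := if b = 0 then OnePoint.infty else ((a / b : ℂ) : CP1)

/-- Homogeneous coordinates of a point of the sphere. -/
def homCoord : CP1 → Fin 2 → ℂ
  | none => ![1, 0]
  | some z => ![z, 1]

theorem homCoord_infty : homCoord OnePoint.infty = ![1, 0] := rfl

theorem homCoord_coe (z : ℂ) : homCoord (z : CP1) = ![z, 1] := rfl

theorem ratio_mul_left {c : ℂ} (hc : c ≠ 0) (a b : ℂ) : ratio (c * a) (c * b) = ratio a b := by
  simp [ratio, hc, mul_div_mul_left]

theorem ratio_eq_ratio {a b a' b' : ℂ} (h : ¬(a = 0 ∧ b = 0)) (h' : ¬(a' = 0 ∧ b' = 0))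
    (hab : a * b' = b * a') : ratio a b = ratio a' b' := by
  by_cases hb : b = 0
  · have ha : a ≠ 0 := fun ha => h ⟨ha, hb⟩
    have hb' : b' = 0 := by simpa [hb, ha] using hab
    simp [ratio, hb, hb']
  · have hb' : b' ≠ 0 := fun hb' => h' ⟨by simpa [hb, hb'] using hab, hb'⟩
    have : a / b = a' / b' := by
      rw [div_eq_div_iff hb hb', hab, mul_comm]
    simp [ratio, hb, hb', this]

/-- Continuity of the projection from `ℂ² ∖ 0` to the sphere; near infinity it is read in the
coordinate `q / p`. -/
theorem tendsto_ratio {ι : Type*} {l : Filter ι} {p q : ι → ℂ} {a b : ℂ}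
    (hp : Tendsto p l (𝓝 a)) (hq : Tendsto q l (𝓝 b)) (h : ¬(a = 0 ∧ b = 0)) :
    Tendsto (fun i => ratio (p i) (q i)) l (𝓝 (ratio a b)) := by
  by_cases hb : b = 0
  · have ha : a ≠ 0 := fun ha => h ⟨ha, hb⟩
    have hlim : Tendsto (fun i => q i / p i) l (𝓝 0) := by
      rw [← zero_div a, ← hb]
      exact hq.div hp ha
    have := tendsto_inv_infty.comp hlim
    rw [ratio, if_pos hb]
    refine this.congr' ?_
    filter_upwards [hp.eventually_ne ha] with i hi
    by_cases hqi : q i = 0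
    · simp [ratio, hqi]
    · simp [ratio, hqi, hi, inv_div]
  · rw [ratio, if_neg hb]
    refine ((OnePoint.continuous_coe.tendsto _).comp (hp.div hq hb)).congr' ?_
    filter_upwards [hq.eventually_ne hb] with i hi
    simp [ratio, hi]

theorem smul_eq_ratio (A : GL (Fin 2) ℂ) (x : CP1) :
    A • x = ratio ((A.1.mulVec (homCoord x)) 0) ((A.1.mulVec (homCoord x)) 1) := by
  induction x using OnePoint.rec with
  | infty => simp [OnePoint.smul_infty_eq_ite, ratio, homCoord_infty, Matrix.mulVec, dotProduct]
  | coe z => simp [OnePoint.smul_some_eq_ite, ratio, homCoord_coe, Matrix.mulVec, dotProduct]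

theorem homCoord_ne_zero (x : CP1) : homCoord x ≠ 0 := by
  induction x using OnePoint.rec with
  | infty => simp [homCoord_infty]
  | coe z => simp [homCoord_coe]

/-- A nonzero matrix annihilates the homogeneous coordinates of at most one point. -/
theorem subsingleton_mulVec_homCoord_eq_zero {B : Matrix (Fin 2) (Fin 2) ℂ} (hB : B ≠ 0) :
    {x : CP1 | B.mulVec (homCoord x) = 0}.Subsingleton := by
  have key (b c : ℂ) : B.mulVec ![b, c] = 0 ↔
      B 0 0 * b + B 0 1 * c = 0 ∧ B 1 0 * b + B 1 1 * c = 0 := by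
    simp [funext_iff, Fin.forall_fin_two]
  have hB' : ¬((B 0 0 = 0 ∧ B 1 0 = 0) ∧ (B 0 1 = 0 ∧ B 1 1 = 0)) := by
    rintro ⟨⟨h1, h2⟩, h3, h4⟩
    apply hB
    ext i j
    fin_cases i <;> fin_cases j <;> simp [h1, h2, h3, h4]
  intro x hx y hy
  change B.mulVec (homCoord x) = 0 at hx
  change B.mulVec (homCoord y) = 0 at hy
  induction x using OnePoint.rec with
  | infty =>
    induction y using OnePoint.rec with
    | infty => rfl
    | coe w =>
      rw [homCoord_infty, key] at hx
      rw [homCoord_coe, key] at hy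
      simp only [mul_one, mul_zero, add_zero] at hx hy
      exact absurd ⟨hx, by simpa [hx.1] using hy.1, by simpa [hx.2] using hy.2⟩ hB'
  | coe z =>
    rw [homCoord_coe, key] at hx
    induction y using OnePoint.rec with
    | infty =>
      rw [homCoord_infty, key] at hy
      simp only [mul_one, mul_zero, add_zero] at hx hy
      exact absurd ⟨hy, by simpa [hy.1] using hx.1, by simpa [hy.2] using hx.2⟩ hB'
    | coe w =>
      rw [homCoord_coe, key] at hy
      simp only [mul_one] at hx hy
      by_contra hzw
      have hzw : z - w ≠ 0 := sub_ne_zero.mpr fun h => hzw (by rw [h])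
      have h0 : B 0 0 = 0 := (mul_eq_zero.mp (show B 0 0 * (z - w) = 0 by
        linear_combination hx.1 - hy.1)).resolve_right hzw
      have h1 : B 1 0 = 0 := (mul_eq_zero.mp (show B 1 0 * (z - w) = 0 by
        linear_combination hx.2 - hy.2)).resolve_right hzw
      exact hB' ⟨⟨h0, h1⟩, by simpa [h0] using hx.1, by simpa [h1] using hx.2⟩

/-- Along an ultrafilter, matrices converge projectively to a nonzero matrix `B`, and the
corresponding Möbius transformations converge wherever `B` determines a value. -/
theorem exists_projective_limit {ι : Type*} (F : Ultrafilter ι) (A : ι → GL (Fin 2) ℂ) :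
    ∃ B : Matrix (Fin 2) (Fin 2) ℂ, B ≠ 0 ∧ ∀ x : CP1, B.mulVec (homCoord x) ≠ 0 →
      Tendsto (fun i => A i • x) F
        (𝓝 (ratio ((B.mulVec (homCoord x)) 0) ((B.mulVec (homCoord x)) 1))) := by
  let a : ι → Fin 2 → Fin 2 → ℂ := fun i r s => A i r s
  have ha (i : ι) : a i ≠ 0 := by
    intro h
    apply (A i).ne_zero
    ext r s
    exact congrFun (congrFun h r) s
  -- Rescaling leaves the Möbius map unchanged and moves the matrices into the compact unit sphere,
  -- whose points are nonzero.
  let N : ι → Fin 2 → Fin 2 → ℂ := fun i => ((‖a i‖⁻¹ : ℝ) : ℂ) • a i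
  have hN (i : ι) : N i ∈ Metric.sphere (0 : Fin 2 → Fin 2 → ℂ) 1 := by
    have := norm_ne_zero_iff.mpr (ha i)
    simp [N, norm_smul, this]
  obtain ⟨B, hB, hFB⟩ := (isCompact_sphere (0 : Fin 2 → Fin 2 → ℂ) 1).ultrafilter_le_nhds
    (F.map N) (le_principal_iff.mpr (mem_map.mpr (univ_mem' hN)))
  have hNB : Tendsto N F (𝓝 B) := hFB
  refine ⟨Matrix.of B, ?_, fun x hx => ?_⟩
  · rintro h0
    have : B = 0 := h0
    simp [this] at hB
  · have hlim (r : Fin 2) : Tendsto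
        (fun i => ((‖a i‖⁻¹ : ℝ) : ℂ) * ((A i).1.mulVec (homCoord x)) r) F
        (𝓝 ((Matrix.of B).mulVec (homCoord x) r)) := by
      have h (s : Fin 2) : Tendsto (fun i => N i r s) F (𝓝 (B r s)) :=
        tendsto_pi_nhds.mp (tendsto_pi_nhds.mp hNB r) s
      have := ((h 0).mul_const (homCoord x 0)).add ((h 1).mul_const (homCoord x 1))
      simp only [Matrix.mulVec, dotProduct, Fin.sum_univ_two, Matrix.of_apply]
      refine this.congr fun i => ?_
      simp only [N, a, Pi.smul_apply, smul_eq_mul]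
      ring
    have hne : ¬((Matrix.of B).mulVec (homCoord x) 0 = 0 ∧
        (Matrix.of B).mulVec (homCoord x) 1 = 0) := by
      rintro ⟨h0, h1⟩
      apply hx
      ext r
      fin_cases r <;> assumption
    refine (tendsto_ratio (hlim 0) (hlim 1) hne).congr fun i => ?_
    have := norm_ne_zero_iff.mpr (ha i)
    rw [ratio_mul_left (by simpa using this), smul_eq_ratio]

/-- Along an ultrafilter, Möbius transformations converge pointwise to a Möbius transformation or,
off one point, to a constant. -/
theorem moebius_tendsto_or_degenerate {ι : Type*} (F : Ultrafilter ι) (g : ι → moebius) :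
    (∃ γ : moebius, ∀ x, Tendsto (fun i => (g i).1 x) F (𝓝 (γ.1 x))) ∨
    ∃ (S : Set CP1) (a : CP1), S.Subsingleton ∧
      ∀ x ∉ S, Tendsto (fun i => (g i).1 x) F (𝓝 a) := by
  choose A hA using fun i => (g i).2
  have hgA (i : ι) (x : CP1) : (g i).1 x = A i • x := by rw [← hA]; rfl
  simp only [hgA]
  obtain ⟨B, hB, hlim⟩ := exists_projective_limit F A
  by_cases hdet : B.det = 0
  · right
    by_cases hx₀ : ∃ x₀, B.mulVec (homCoord x₀) ≠ 0
    · obtain ⟨x₀, hx₀⟩ := hx₀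
      refine ⟨_, ratio ((B.mulVec (homCoord x₀)) 0) ((B.mulVec (homCoord x₀)) 1),
        subsingleton_mulVec_homCoord_eq_zero hB, fun x hx => ?_⟩
      · have hne {y : CP1} (hy : B.mulVec (homCoord y) ≠ 0) :
            ¬(B.mulVec (homCoord y) 0 = 0 ∧ B.mulVec (homCoord y) 1 = 0) := by
          rintro ⟨h0, h1⟩
          apply hy
          ext r
          fin_cases r <;> assumption
        rw [ratio_eq_ratio (hne hx₀) (hne hx)]
        · exact hlim x hx
        -- The vectors `B x₀` and `B x` span an area equal to `det B` times that of `x₀` and `x`,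
        -- hence zero: they are proportional.
        · rw [Matrix.det_fin_two] at hdet
          simp only [Matrix.mulVec, dotProduct, Fin.sum_univ_two]
          linear_combination (homCoord x₀ 0 * homCoord x 1 - homCoord x₀ 1 * homCoord x 0) * hdet
    · push Not at hx₀
      have := subsingleton_mulVec_homCoord_eq_zero hB (hx₀ OnePoint.infty) (hx₀ ((0 : ℂ) : CP1))
      exact absurd this (OnePoint.infty_ne_coe _)
  · left
    refine ⟨⟨moebiusHom (Matrix.GeneralLinearGroup.mkOfDetNeZero B hdet), _, rfl⟩, fun x => ?_⟩
    change Tendsto _ _ (𝓝 (Matrix.GeneralLinearGroup.mkOfDetNeZero B hdet • x))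
    rw [smul_eq_ratio]
    refine hlim x fun h => homCoord_ne_zero x ?_
    exact Matrix.eq_zero_of_mulVec_eq_zero hdet h

/-- Puts any point, including infinity, inside a disc of some affine coordinate, as the basic
neighbourhoods require. -/
theorem exists_moebius_coe_eq (x : CP1) : ∃ (γ : moebius) (z : ℂ), γ.1 (z : CP1) = x := by
  induction x using OnePoint.rec with
  | infty =>
    refine ⟨⟨moebiusHom (Matrix.GeneralLinearGroup.mkOfDetNeZero !![0, 1; 1, 0] (by simp)),
      _, rfl⟩, 0, ?_⟩
    change Matrix.GeneralLinearGroup.mkOfDetNeZero (!![0, 1; 1, 0] : Matrix _ _ ℂ) _ •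
      ((0 : ℂ) : CP1) = _
    rw [OnePoint.smul_some_eq_ite]
    simp [Matrix.GeneralLinearGroup.mkOfDetNeZero]
  | coe z => exact ⟨1, z, rfl⟩

theorem dense_compl_of_subsingleton {S : Set CP1} (hS : S.Subsingleton) : Dense Sᶜ := by
  rcases hS.eq_empty_or_singleton with rfl | ⟨x, rfl⟩
  · simp
  · induction x using OnePoint.rec with
    | infty => exact dense_compl_singleton _
    | coe z => exact dense_compl_singleton _

/-! ### Evaluation and reparametrization of `L_k^p`-maps -/

theorem sobolevNorm_zero {E : Type*} [NormedAddCommGroup E] [NormedSpace ℝ E] (k : ℕ) (p : ℝ)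
    (D : Set ℂ) : sobolevNorm k p D (fun _ => (0 : E)) = 0 := by
  have hjet : IsSobolevJet k p D (fun _ => (0 : E)) fun _ _ _ => 0 :=
    ⟨MeasureTheory.MemLp.zero', fun a b _ => ⟨MeasureTheory.MemLp.zero', fun φ _ _ _ => by simp⟩⟩
  refine le_antisymm ((iInf_le _ ⟨_, hjet⟩).trans ?_) bot_le
  simp

namespace LkpMap

variable {m : ℕ} {M : Type*} [TopologicalSpace M] [ChartedSpace (EuclideanSpace ℝ (Fin m)) M]
  {k : ℕ} {p : ℝ}

theorem isOpen_basicNhd (u : LkpMap m M k p) (γ : moebius) (z : ℂ) {r : ℝ} (hr : 0 < r)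
    {ψ : OpenPartialHomeomorph M (EuclideanSpace ℝ (Fin m))}
    (hψ : ψ ∈ IsManifold.maximalAtlas (𝓡 m) ∞ M) (had : Adapted m M u.toMap γ z r ψ)
    {ε : ENNReal} (hε : 0 < ε) : IsOpen (basicNhd u γ z r ψ ε) :=
  .basic _ ⟨u, γ, z, r, ψ, ε, hr, hψ, had, hε, rfl⟩

theorem mem_basicNhd_self (u : LkpMap m M k p) {γ : moebius} {z : ℂ} {r : ℝ}
    {ψ : OpenPartialHomeomorph M (EuclideanSpace ℝ (Fin m))} (had : Adapted m M u.toMap γ z r ψ)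
    {ε : ENNReal} (hε : 0 < ε) : u ∈ basicNhd u γ z r ψ ε :=
  ⟨had, by simpa only [sub_self, sobolevNorm_zero] using hε⟩

/-- The `L_k^p`-topology refines the compact-open topology. -/
theorem continuous_eval [IsManifold (𝓡 m) ∞ M] :
    Continuous fun q : LkpMap m M k p × CP1 => q.1.toMap q.2 := by
  rw [continuous_iff_continuousAt]
  rintro ⟨u, x⟩ O hO
  obtain ⟨O', hO'O, hO', hxO'⟩ := mem_nhds_iff.mp hO
  obtain ⟨γ, z, rfl⟩ := exists_moebius_coe_eq x
  -- With the chart shrunk to `O'`, being `Adapted` already forces values in `O'`.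
  let ψ := (chartAt (EuclideanSpace ℝ (Fin m)) (u.toMap (γ.1 (z : CP1)))).restr O'
  have hψ : ψ ∈ IsManifold.maximalAtlas (𝓡 m) ∞ M :=
    restr_mem_maximalAtlas _ (IsManifold.chart_mem_maximalAtlas _) hO'
  have hsource : ψ.source = (chartAt (EuclideanSpace ℝ (Fin m)) (u.toMap (γ.1 (z : CP1)))).source
      ∩ O' := by
    simp [ψ, hO'.interior_eq]
  have hcont : Continuous fun w : ℂ => u.toMap (γ.1 (w : CP1)) :=
    u.toMap.continuous.comp (γ.1.continuous.comp OnePoint.continuous_coe)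
  have hpre : (fun w : ℂ => u.toMap (γ.1 (w : CP1))) ⁻¹' ψ.source ∈ 𝓝 z := by
    refine hcont.continuousAt.preimage_mem_nhds (ψ.open_source.mem_nhds ?_)
    rw [hsource]
    exact ⟨mem_chart_source _ _, hxO'⟩
  obtain ⟨r, hr, hball⟩ := Metric.nhds_basis_closedBall.mem_iff.mp hpre
  have had : Adapted m M u.toMap γ z r ψ := fun w hw => hball hw
  have hopen : IsOpen (γ.1 '' ((fun w : ℂ => (w : CP1)) '' Metric.ball z r)) :=
    γ.1.isOpenMap _ (OnePoint.isOpenEmbedding_coe.isOpenMap _ Metric.isOpen_ball)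
  refine mem_map.mpr ?_
  -- Only the `Adapted` half of the neighbourhood matters, so `ε = ⊤` suffices.
  filter_upwards [prod_mem_nhds
    ((isOpen_basicNhd u γ z hr hψ had ENNReal.zero_lt_top).mem_nhds
      (mem_basicNhd_self u had ENNReal.zero_lt_top))
    (hopen.mem_nhds ⟨_, ⟨z, Metric.mem_ball_self hr, rfl⟩, rfl⟩)]
  rintro ⟨h, _⟩ ⟨hh, _, ⟨w, hw, rfl⟩, rfl⟩
  have := hh.1 w (Metric.ball_subset_closedBall hw)
  rw [hsource] at this
  exact hO'O this.2

/-- Affine coordinates are permuted by Möbius maps: `h ∘ g` read in `γ` is `h` read in `g * γ`, so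
basic neighbourhoods pull back to basic neighbourhoods. -/
theorem continuous_comp (g : moebius) :
    Continuous fun u : LkpMap m M k p => u.comp g := by
  refine continuous_generateFrom_iff.mpr ?_
  rintro _ ⟨u, γ, z, r, ψ, ε, hr, hψ, had, hε, rfl⟩
  have hcancel (w : ℂ) : g⁻¹.1 ((g * γ).1 (w : CP1)) = γ.1 (w : CP1) := by
    change (g⁻¹ * (g * γ)).1 (w : CP1) = _
    rw [inv_mul_cancel_left]
  have had' : Adapted m M (u.comp g⁻¹).toMap (g * γ) z r ψ := fun w hw => by
    change u.toMap (g⁻¹.1 ((g * γ).1 (w : CP1))) ∈ _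
    rw [hcancel]
    exact had w hw
  convert isOpen_basicNhd (u.comp g⁻¹) (g * γ) z hr hψ had' hε using 1
  have hrep : localRep m M (u.comp g⁻¹).toMap (g * γ) ψ = localRep m M u.toMap γ ψ := by
    funext w
    change ψ (u.toMap (g⁻¹.1 ((g * γ).1 (w : CP1)))) = _
    rw [hcancel]
    rfl
  ext h
  simp only [basicNhd, hrep]
  rfl

/-- If maps `h` tend to `u₁` and their reparametrizations `h ∘ g⁻¹` tend to `u₂`, then `u₁ = u₂`
or the `g⁻¹` tend to a Möbius transformation that carries `u₁` to `u₂`. -/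
theorem eq_or_exists_eq_comp [T2Space M] [IsManifold (𝓡 m) ∞ M] {ι : Type*} (F : Ultrafilter ι)
    {g : ι → moebius} {h : ι → LkpMap m M k p} {u₁ u₂ : LkpMap m M k p}
    (h₁ : Tendsto h F (𝓝 u₁)) (h₂ : Tendsto (fun i => (h i).comp (g i)⁻¹) F (𝓝 u₂)) :
    u₂ = u₁ ∨ ∃ γ : moebius, u₂ = u₁.comp γ ∧
      ∀ x, Tendsto (fun i => (g i)⁻¹.1 x) F (𝓝 (γ.1 x)) := by
  have eval {v : ι → LkpMap m M k p} {v₀ : LkpMap m M k p} {x : ι → CP1} {x₀ : CP1}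
      (hv : Tendsto v F (𝓝 v₀)) (hx : Tendsto x F (𝓝 x₀)) :
      Tendsto (fun i => (v i).toMap (x i)) F (𝓝 (v₀.toMap x₀)) :=
    (continuous_eval.tendsto (v₀, x₀)).comp (hv.prodMk_nhds hx)
  have push {x y : CP1} (hxy : Tendsto (fun i => (g i)⁻¹.1 x) F (𝓝 y)) :
      u₂.toMap x = u₁.toMap y := by
    have h₁' := eval h₁ hxy
    exact tendsto_nhds_unique (eval h₂ tendsto_const_nhds) h₁'
  rcases moebius_tendsto_or_degenerate F (fun i => (g i)⁻¹) with ⟨γ, hγ⟩ | ⟨S, a, hS, ha⟩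
  · exact Or.inr ⟨γ, ext fun x => push (hγ x), hγ⟩
  · left
    -- The exceptional point is absorbed by continuity of `u₂`, since the sphere has no isolated
    -- points.
    have hconst : ∀ x, u₂.toMap x = u₁.toMap a := fun x =>
      congrFun (Continuous.ext_on (dense_compl_of_subsingleton hS) u₂.toMap.continuous
        continuous_const fun x hx => push (ha x hx)) x
    refine ext fun y => ?_
    -- Now `u₁` is shown constant: `h i y` is `h i ∘ (g i)⁻¹` at `g i y`, and these points converge
    -- by compactness, so `u₁ y` is a value of `u₂`.
    obtain ⟨y', -, hy'⟩ := isCompact_univ.ultrafilter_le_nhds (F.map fun i => (g i).1 y)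
      (by simp)
    have hlim : Tendsto (fun i => (h i).toMap y) F (𝓝 (u₂.toMap y')) := by
      refine (eval h₂ (show Tendsto (fun i => (g i).1 y) F (𝓝 y') from hy')).congr fun i => ?_
      change (h i).toMap (((g i)⁻¹ * g i).1 y) = _
      rw [inv_mul_cancel]
      rfl
    rw [hconst y, ← hconst y']
    exact tendsto_nhds_unique hlim (eval h₁ tendsto_const_nhds)

end LkpMap

/-! ### The action of the reparametrization group on nodal maps -/

namespace NodalMap

variable {V : Type*} {T : StabilizedTree V} {m : ℕ} {M : Type*} [TopologicalSpace M]
  [ChartedSpace (EuclideanSpace ℝ (Fin m)) M] {k : ℕ} {p : ℝ}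

theorem continuous_point_map : Continuous fun f : NodalMap T m M k p => (f.point, f.map) :=
  continuous_induced_dom

theorem continuous_map (v : V) : Continuous fun f : NodalMap T m M k p => f.map v :=
  (continuous_apply v).comp (continuous_snd.comp continuous_point_map)

theorem continuous_point : Continuous fun f : NodalMap T m M k p => f.point :=
  continuous_fst.comp continuous_point_map

variable [Finite V]

instance : ContinuousConstSMul T.reparamGroup (NodalMap T m M k p) where
  continuous_const_smul g := continuous_induced_rng.mpr <| continuous_point.prodMk <|
    continuous_pi fun v => (LkpMap.continuous_comp (g.1 v)⁻¹).comp (continuous_map v)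

theorem isOpen_saturation {U : Set (NodalMap T m M k p)} (hU : IsOpen U) :
    IsOpen (saturation U) := by
  have : saturation U = ⋃ g : T.reparamGroup, (g • ·) '' U := by
    ext h
    simp [saturation, eq_comm]
  rw [this]
  exact isOpen_iUnion fun g => isOpenMap_smul g _ hU

/-- A cluster pair of the action relation consists of points of the same orbit. -/
theorem exists_smul_eq_of_tendsto [T2Space M] [IsManifold (𝓡 m) ∞ M] {ι : Type*}
    (F : Ultrafilter ι) {g : ι → T.reparamGroup} {h : ι → NodalMap T m M k p}
    {f₁ f₂ : NodalMap T m M k p} (h₁ : Tendsto h F (𝓝 f₁))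
    (h₂ : Tendsto (fun i => g i • h i) F (𝓝 f₂)) : ∃ g₀ : T.reparamGroup, g₀ • f₁ = f₂ := by
  have hpoint : f₁.point = f₂.point := by
    have h₂' := (continuous_point.tendsto _).comp h₂
    exact tendsto_nhds_unique ((continuous_point.tendsto _).comp h₁) h₂'
  have hmap (v : V) : ∃ γ ∈ T.componentGroup v, f₂.map v = (f₁.map v).comp γ := by
    rcases LkpMap.eq_or_exists_eq_comp F (g := fun i => (g i).1 v)
      (((continuous_map v).tendsto _).comp h₁) (((continuous_map v).tendsto _).comp h₂)
      with heq | ⟨γ, hγ, hlim⟩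
    · exact ⟨1, one_mem _, by rw [heq]; rfl⟩
    · have hmem (i : ι) : ((g i).1 v)⁻¹ ∈ T.componentGroup v :=
        inv_mem ((g i).2 v (Set.mem_univ v))
      -- Membership in the component group is a pointwise closed condition, so it passes to the
      -- limit.
      refine ⟨γ, ⟨fun hv => Subtype.ext (Homeomorph.ext fun x => ?_), fun j d hd => ?_⟩, hγ⟩
      · exact tendsto_nhds_unique (hlim x) (tendsto_const_nhds.congr fun i => by
          rw [(hmem i).1 hv])
      · exact tendsto_nhds_unique (hlim (stdPoint j)) (tendsto_const_nhds.congr fun i =>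
          ((hmem i).2 j d hd).symm)
  choose γ hγ hγmap using hmap
  refine ⟨⟨fun v => (γ v)⁻¹, fun v _ => inv_mem (hγ v)⟩, NodalMap.ext hpoint (funext fun v => ?_)⟩
  change (f₁.map v).comp ((γ v)⁻¹)⁻¹ = _
  rw [inv_inv, hγmap]

theorem exists_open_disjoint_saturation [T2Space M] [IsManifold (𝓡 m) ∞ M]
    {f₁ f₂ : NodalMap T m M k p}
    (hne : MulAction.orbit T.reparamGroup f₁ ≠ MulAction.orbit T.reparamGroup f₂) :
    ∃ U₁ U₂ : Set (NodalMap T m M k p), IsOpen U₁ ∧ IsOpen U₂ ∧ f₁ ∈ U₁ ∧ f₂ ∈ U₂ ∧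
      saturation U₁ ∩ saturation U₂ = ∅ := by
  let act : T.reparamGroup × NodalMap T m M k p → NodalMap T m M k p := fun q => q.1 • q.2
  -- This filter is nontrivial exactly when every neighbourhood of `f₁` has a translate meeting
  -- every neighbourhood of `f₂`; an ultrafilter below it supplies the families `g` and `h`.
  have hbot : ¬ (comap Prod.snd (𝓝 f₁) ⊓ comap act (𝓝 f₂)).NeBot := fun hF => by
    let F := Ultrafilter.of (comap Prod.snd (𝓝 f₁) ⊓ comap act (𝓝 f₂))
    have hF := Ultrafilter.of_le (comap Prod.snd (𝓝 f₁) ⊓ comap act (𝓝 f₂))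
    obtain ⟨g, hg⟩ := exists_smul_eq_of_tendsto F (g := Prod.fst) (h := Prod.snd)
      (f₁ := f₁) (f₂ := f₂)
      (tendsto_iff_comap.mpr (hF.trans inf_le_left)) (tendsto_iff_comap.mpr (hF.trans inf_le_right))
    exact hne (by rw [← hg, MulAction.orbit_smul])
  rw [not_neBot, ← disjoint_iff] at hbot
  obtain ⟨U₁, ⟨h₁, hU₁⟩, U₂, ⟨h₂, hU₂⟩, hdisj⟩ :=
    (((nhds_basis_opens f₁).comap Prod.snd).disjoint_iff ((nhds_basis_opens f₂).comap act)).mp hbot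
  refine ⟨U₁, U₂, hU₁, hU₂, h₁, h₂, Set.eq_empty_iff_forall_notMem.mpr ?_⟩
  rintro _ ⟨⟨g, f, hf, rfl⟩, ⟨g', f', hf', hff'⟩⟩
  -- If `g • f = g' • f'`, then `g'⁻¹ * g` carries `f ∈ U₁` to `f' ∈ U₂`.
  refine Set.disjoint_left.mp hdisj (show (g'⁻¹ * g, f) ∈ _ from hf) ?_
  change (g'⁻¹ * g) • f ∈ U₂
  rwa [mul_smul, hff', inv_smul_smul]

theorem t2Space_quotient [T2Space M] [IsManifold (𝓡 m) ∞ M] :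
    T2Space (Quotient (MulAction.orbitRel T.reparamGroup (NodalMap T m M k p))) := by
  refine ⟨fun x y => Quotient.inductionOn₂ x y fun f₁ f₂ hxy => ?_⟩
  have hne : MulAction.orbit T.reparamGroup f₁ ≠ MulAction.orbit T.reparamGroup f₂ := fun h =>
    hxy (Quotient.sound (MulAction.orbitRel_apply.mpr (MulAction.orbit_eq_iff.mp h)))
  obtain ⟨U₁, U₂, hU₁, hU₂, h₁, h₂, hdisj⟩ := exists_open_disjoint_saturation hne
  -- Images of `U₁` and `U₂` are open in the quotient, and a common point would give a common point
  -- of the saturations.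
  refine ⟨_, _, isOpenMap_quotient_mk'_mul _ hU₁, isOpenMap_quotient_mk'_mul _ hU₂,
    ⟨f₁, h₁, rfl⟩, ⟨f₂, h₂, rfl⟩, Set.disjoint_left.mpr ?_⟩
  rintro _ ⟨a, ha, rfl⟩ ⟨b, hb, hab⟩
  obtain ⟨g, hg⟩ := MulAction.orbitRel_apply.mp (Quotient.exact hab)
  exact Set.eq_empty_iff_forall_notMem.mp hdisj b
    ⟨⟨g, a, ha, hg.symm⟩, ⟨1, b, hb, (one_smul _ b).symm⟩⟩

end NodalMap

end NodalMaps

end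

theorem theorem1p1 {V : Type*} [Finite V] (T : NodalMaps.StabilizedTree V)
    (m : ℕ) (M : Type*) [TopologicalSpace M] [T2Space M]
    [ChartedSpace (EuclideanSpace ℝ (Fin m)) M] [IsManifold (𝓡 m) ∞ M]
    (k : ℕ) (p : ℝ) (hp : 1 ≤ p) (hkp : 1 ≤ ⌊(k : ℝ) - 2 / p⌋) :
    (∀ f₁ f₂ : NodalMaps.NodalMap T m M k p,
      MulAction.orbit T.reparamGroup f₁ ≠ MulAction.orbit T.reparamGroup f₂ →
      ∃ U₁ U₂ : Set (NodalMaps.NodalMap T m M k p),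
        IsOpen U₁ ∧ IsOpen U₂ ∧ f₁ ∈ U₁ ∧ f₂ ∈ U₂ ∧
        IsOpen (NodalMaps.NodalMap.saturation U₁) ∧ IsOpen (NodalMaps.NodalMap.saturation U₂) ∧
        NodalMaps.NodalMap.saturation U₁ ∩ NodalMaps.NodalMap.saturation U₂ = ∅) ∧
    T2Space (Quotient (MulAction.orbitRel T.reparamGroup (NodalMaps.NodalMap T m M k p))) := by
  exact ⟨fun _ _ hne =>
    let ⟨U₁, U₂, hU₁, hU₂, h₁, h₂, hdisj⟩ := NodalMaps.NodalMap.exists_open_disjoint_saturation hne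
    ⟨U₁, U₂, hU₁, hU₂, h₁, h₂, NodalMaps.NodalMap.isOpen_saturation hU₁,
      NodalMaps.NodalMap.isOpen_saturation hU₂, hdisj⟩,
    NodalMaps.NodalMap.t2Space_quotient⟩
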